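/- For planar vectors write $[x,y]$ for the determinant. Let $n\ge 2$ and let $P$ be a convex polygon with nonempty interior whose vertices are listed counterclockwise (repetitions allowed, indices mod $2n$) as $P_1,\dots,P_{2n}$ so that there are vectors $e_i$ with $e_{i+n}=-e_i$, $[e_i,e_j]>0$ for $i<j<i+n$, each side $P_{i+1}-P_i$ is a nonnegative multiple of $e_i$, and of two opposite sides $P_iP_{i+1}$, $P_{i+n}P_{i+n+1}$ at most one degenerates to a point. (Every convex polygon has such a listing, $n$ being the number of distinct directions of its side lines.) Fix $a>0$ and put $$U_i=\tfrac1{2a}(P_i-P_{i+n}),\qquad V_{i+\frac12}=\frac{U_{i+1}-U_i}{[U_i,U_{i+1}]},\qquad M_i=\tfrac12(P_i+P_{i+n});$$ $U$ is the unit ball (homothetic to $P+(-P)$), $V$ the dual ball, and $M$ the central equidistant of $P$. For a centered $2n$-gon $B$ with dual $B^*_{i+\frac12}=(B_{i+1}-B_i)/[B_i,B_{i+1}]$ and a closed polygon $Q$ with $Q_{i+1}-Q_i=\alpha_{i+\frac12}(B_{i+1}-B_i)$ and $Q_{i+n}=Q_i$ for all $i$, the involute $\mathrm{Inv}(Q)$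 has the vertices $$Q_i+\beta_iB^*_{i+\frac12},\qquad \beta_i=\tfrac12\sum_{j=i}^{i+n-1}\alpha_{j+\frac12}[B_j,B_{j+1}].$$ Put $M(0)=M$, $N(k+1)=\mathrm{Inv}(M(k))$ (with $B=U$, vertices $N_{i+\frac12}(k+1)$) and $M(k+1)=\mathrm{Inv}(N(k+1))$ (with $B=V$; the vertex between the indices $i-\frac12$ and $i+\frac12$ is $M_i(k+1)$), for $k\ge0$. The evolute of a polygon $Q$ with respect to a ball $B$ with parallel sides is the polygon with vertices $Q_i-\mu B_i=Q_{i+1}-\mu B_{i+1}$, where $Q_{i+1}-Q_i=\mu(B_{i+1}-B_i)$. A closed polygon $Q$ (not necessarily convex) is said to have constant $B$-width if its sides are parallel to those of $B$, $Q_i-Q_{i+n}=\lambda(B_i-B_{i+n})$ for all $i$ with a constant $\lambda$, and for all sufficiently large $c$ the polygon with vertices $Q_i+cB_i$ has sides that are nonnegative multiples of those of $B$ and is a convex polygon of constant width in the norm with unit ball $B$: with $h(S)(v)=\sup_{x\in S}[x,v]$, its width $h(v)+h(-v)$ is the same for all $v$ with $h(B)(v)=1$. For a closed polygon $R$ let $\overline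 R$ be the closed region bounded by $R$, that is, the complement of the set of points off $R$ that can be joined to points arbitrarily far away by paths not meeting $R$. Then: (1) for every $k\ge0$, $N(k+1)$ is the central involute of $M(k)$ with respect to $V$ (its evolute is $M(k)$, and $N_{i+n+\frac12}(k+1)=N_{i+\frac12}(k+1)$), and $M(k+1)$ is the central involute of $N(k+1)$ with respect to $U$ (its evolute is $N(k+1)$, and $M_{i+n}(k+1)=M_i(k+1)$); (2) every $M(k)$ has constant $U$-width and every $N(k+1)$ has constant $V$-width; (3) $\overline{M(0)}\supset\overline{N(1)}\supset\overline{M(1)}\supset\overline{N(2)}\supset\cdots$; (4) the intersection $O(P)$ of all these regions consists of a single point $o$ (the central point of $P$), and in the space $(\mathbb R^2)^n$ of $n$-gons, represented by their vertices, $M(k)\to(o,\dots,o)$ and $N(k)\to(o,\dots,o)$ as $k\to\infty$. -/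

import Mathlib

open Set Filter Topology

noncomputable section

/-- The Euclidean plane. -/
abbrev Plane : Type := EuclideanSpace ℝ (Fin 2)

/-- The determinant `[x, y]` of a pair of planar vectors. -/
def det2 (x y : Plane) : ℝ := x 0 * y 1 - x 1 * y 0

/-- The side vector of a polygon, from vertex `i` to vertex `i + 1`. All polygons are given by
their vertices, indexed periodically by the integers. -/
def side (Q : ℤ → Plane) (i : ℤ) : Plane := Q (i + 1) - Q i

/-- `P` lists, counterclockwise and with period `2 * n`, the vertices of a (nondegenerate) convex
polygon with parallel opposite sides in the wide sense: there are directions `e i`, in strictly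
increasing (counterclockwise) order over each half turn, with `e (i + n) = - e i`, such that the
side from `P i` to `P (i + 1)` is a nonnegative multiple of `e i`; one of two opposite
sides (but not both) may degenerate to a point. Every convex polygon has such a listing, `n` being
the number of distinct lines through the origin that are parallel to sides of the polygon. -/
structure IsConvexPolygonListing (n : ℕ) (P : ℤ → Plane) : Prop where
  two_le : 2 ≤ n
  periodic : ∀ i : ℤ, P (i + 2 * n) = P i
  directions : ∃ e : ℤ → Plane,
    (∀ i : ℤ, e (i + n) = - e i) ∧
    (∀ i j : ℤ, i < j → j < i + n → 0 < det2 (e i) (e j)) ∧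
    (∀ i : ℤ, ∃ t : ℝ, 0 ≤ t ∧ side P i = t • e i) ∧
    (∀ i : ℤ, side P i ≠ 0 ∨ side P (i + n) ≠ 0)

/-- The vertices `U i = (P i - P (i + n)) / (2 a)` of the unit ball, which is homothetic to
`P + (-P)`. -/
def unitBall (n : ℕ) (a : ℝ) (P : ℤ → Plane) (i : ℤ) : Plane :=
  (1 / (2 * a)) • (P i - P (i + n))

/-- The dual polygon `V` of a polygon `B`; the value at `i` is the vertex with index `i + 1/2`,
`(B (i + 1) - B i) / [B i, B (i + 1)]`. -/
def dualBall (B : ℤ → Plane) (i : ℤ) : Plane :=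
  (1 / det2 (B i) (B (i + 1))) • side B i

/-- The central equidistant `M i = (P i + P (i + n)) / 2` of `P`. -/
def centralEquidistant (n : ℕ) (P : ℤ → Plane) (i : ℤ) : Plane :=
  (1 / 2 : ℝ) • (P i + P (i + n))

/-- The number `α` in `Q (i + 1) - Q i = α • (B (i + 1) - B i)`, for polygons with parallel
corresponding sides. -/
def sideRatio (B Q : ℤ → Plane) (i : ℤ) : ℝ :=
  det2 (B i) (side Q i) / det2 (B i) (B (i + 1))

/-- The number `β i = (1 / 2) ∑_{j = i}^{i + n - 1} α j [B j, B (j + 1)]`. -/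
def halfLength (n : ℕ) (B Q : ℤ → Plane) (i : ℤ) : ℝ :=
  (1 / 2) * ∑ j ∈ Finset.range n, sideRatio B Q (i + j) * det2 (B (i + j)) (B (i + j + 1))

/-- The involute of the polygon `Q` whose sides are parallel to those of the ball `B`: the value
at `i` is the vertex with index `i + 1/2`, `Q i + β i • V i` with `V` the dual of `B`. -/
def involute (n : ℕ) (B Q : ℤ → Plane) (i : ℤ) : Plane :=
  Q i + halfLength n B Q i • dualBall B i

/-- The polygons `M(0) = M`, `M(k + 1) = Inv (Inv (M(k)))`. The first involute is taken with
respect to `U` and has half-integer indices (index `i + 1/2` is stored at `i`), the second one is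
taken with respect to `V`; the vertex of the latter that lies between the indices `i - 1/2` and
`i + 1/2` is the one with index `i`. -/
def polyM (n : ℕ) (a : ℝ) (P : ℤ → Plane) : ℕ → ℤ → Plane
  | 0 => centralEquidistant n P
  | k + 1 => fun i =>
      involute n (dualBall (unitBall n a P)) (involute n (unitBall n a P) (polyM n a P k)) (i - 1)

/-- The polygons `N(k + 1) = Inv (M(k))`: `polyN n a P k i` is the vertex of `N(k + 1)` with
index `i + 1/2`. -/
def polyN (n : ℕ) (a : ℝ) (P : ℤ → Plane) (k : ℕ) : ℤ → Plane :=
  involute n (unitBall n a P) (polyM n a P k)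

/-- `E` is the evolute of `Q` with respect to the ball `B` (`E i` has index `i + 1/2`): it is
`Q i - μ • B i = Q (i + 1) - μ • B (i + 1)`, where `Q (i + 1) - Q i = μ • (B (i + 1) - B i)`. -/
def IsEvolute (B Q E : ℤ → Plane) : Prop :=
  ∀ i : ℤ, ∃ μ : ℝ, side Q i = μ • side B i ∧
    E i = Q i - μ • B i ∧ E i = Q (i + 1) - μ • B (i + 1)

/-- `Q` is the central involute of `E` with respect to the ball `B`: its evolute is `E`, and it is
the central one (`Q (i + n) = Q i`) among the polygons with this property. -/
def IsCentralInvolute (n : ℕ) (B E Q : ℤ → Plane) : Prop :=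
  IsEvolute B Q E ∧ ∀ i : ℤ, Q (i + n) = Q i

/-- The support function of a set at the functional `[·, v]`. -/
def supportFn (S : Set Plane) (v : Plane) : ℝ := sSup ((fun x => det2 x v) '' S)

/-- A planar set `S` has constant width with respect to the unit ball `K`: the width
`h(S)(v) + h(S)(-v)` is the same for all `v` of dual norm one. -/
def SetHasConstantWidth (K S : Set Plane) : Prop :=
  ∃ w : ℝ, ∀ v : Plane, supportFn K v = 1 → supportFn S v + supportFn S (-v) = w

/-- A closed, possibly non-convex polygon `Q` has constant width with respect to the centered
`2 * n`-gon `B`: sides and diagonals of `Q` are parallel to the corresponding ones of `B`, the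
diagonals with a common ratio, and the equidistants `Q + c B` with large `c` are convex polygons
(with sides nonnegative multiples of those of `B`) whose width is constant. -/
structure HasConstantWidth (n : ℕ) (B Q : ℤ → Plane) : Prop where
  sides : ∀ i : ℤ, ∃ t : ℝ, side Q i = t • side B i
  diagonals : ∃ a : ℝ, ∀ i : ℤ, Q i - Q (i + n) = a • (B i - B (i + n))
  equidistants : ∃ c₀ : ℝ, ∀ c : ℝ, c₀ ≤ c →
    (∀ i : ℤ, ∃ t : ℝ, 0 ≤ t ∧ side (fun j => Q j + c • B j) i = t • side B i) ∧
    SetHasConstantWidth (convexHull ℝ (range B)) (convexHull ℝ (range fun j => Q j + c • B j))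

/-- The closed polygonal curve with the given vertices. -/
def polyCurve (Q : ℤ → Plane) : Set Plane := ⋃ i : ℤ, segment ℝ (Q i) (Q (i + 1))

/-- The exterior of a closed polygon: the points off the curve from which one gets
arbitrarily far by paths that do not meet the curve. -/
def polyExterior (Q : ℤ → Plane) : Set Plane :=
  {x | x ∉ polyCurve Q ∧ ¬ Bornology.IsBounded {y | JoinedIn (polyCurve Q)ᶜ x y}}

/-- The closed region bounded by a closed polygon: the complement of its exterior. -/
def polyRegion (Q : ℤ → Plane) : Set Plane := (polyExterior Q)ᶜ

/-- The `n`-gon `(Q 1, …, Q n)` as a point of `(ℝ²)ⁿ`. -/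
def toNGon (n : ℕ) (Q : ℤ → Plane) : Fin n → Plane := fun i => Q ((i : ℕ) + 1)

end

/-!
For a polygon `Q` with `Q (i + n) = Q i` and sides parallel to those of a centered `2 * n`-gon `B`
(`IsAdapted`), everything depends on the side ratios `α i` and the radii `β i` of the involute `N`.
As `β (i + 1) = β i - α i * [B i, B (i + 1)]`, the sides of `N` are `β (i + 1)` times those of the
dual `V` and the evolute of `N` is `Q`. The dual of a ball is a ball (`IsBall.dual`), and the dual
of `V` is `-B` up to the indexing (`IsBall.dual_dual`), so the step from `N` back to polygons
parallel to `B` is an instance of the first one.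

Constant width (`IsAdapted.hasConstantWidth`). The equidistant `Q + c B` is extreme in the same
directions at the same vertices as `B`, and `Q` is the same at opposite vertices, so that its
contributions to the width cancel.

Nested regions (`IsAdapted.polyRegion_involute_subset`). Off `Q`, the condition that only one
tangent of `Q` passes through a point (`HasUniqueTangent`) is open and closed, and it holds far
away; hence it holds at all exterior points of `Q`. The tangents of `Q` are the normals of the
involute `N`, and a point with a single normal does not lie on `N`
(`IsAdapted.notMem_polyCurve_involute`). So a path to infinity that avoids `Q` avoids `N`.

Convergence (`tendsto_sideRatio`). On side ratios, the double involute `α ↦ α'` inverts a discrete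
Sturm–Liouville operator: with `w i = [B i, B (i + 1)]` and `w' i = [V i, V (i + 1)]`,
`β (i + 1) - β i = - w i * α i` and `α' (i + 1) - α' i = w' i * β (i + 1)`. It is therefore
symmetric, and the moments `∑ w α ^ 2`, `∑ w' β ^ 2` along an orbit form a convex sequence. By the
nesting of the regions the orbit is bounded, so the increments of the orbit tend to zero. Fixed
points of the operator have the form `[x, V i]` with a vector `x`, and these are orthogonal to the
ratios of polygons that close up after `n` steps; hence the ratios themselves tend to zero. The
nested compact regions thus shrink to a point.
-/

/-! ### Planar determinants and sides -/

lemma det2_add_left (x y z : Plane) : det2 (x + y) z = det2 x z + det2 y z := by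
  simp [det2]; ring

lemma det2_add_right (x y z : Plane) : det2 x (y + z) = det2 x y + det2 x z := by
  simp [det2]; ring

lemma det2_sub_left (x y z : Plane) : det2 (x - y) z = det2 x z - det2 y z := by
  simp [det2]; ring

lemma det2_sub_right (x y z : Plane) : det2 x (y - z) = det2 x y - det2 x z := by
  simp [det2]; ring

lemma det2_neg_left (x y : Plane) : det2 (-x) y = -det2 x y := by
  simp [det2]; ring

lemma det2_neg_right (x y : Plane) : det2 x (-y) = -det2 x y := by
  simp [det2]; ring

lemma det2_smul_left (t : ℝ) (x y : Plane) : det2 (t • x) y = t * det2 x y := by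
  simp [det2]; ring

lemma det2_smul_right (t : ℝ) (x y : Plane) : det2 x (t • y) = t * det2 x y := by
  simp [det2]; ring

lemma det2_self (x : Plane) : det2 x x = 0 := by
  simp [det2]; ring

lemma det2_swap (x y : Plane) : det2 x y = -det2 y x := by
  simp only [det2]; ring

lemma det2_zero_left (x : Plane) : det2 0 x = 0 := by
  simp [det2]

lemma det2_zero_right (x : Plane) : det2 x 0 = 0 := by
  simp [det2]

lemma det2_sum_right (x : Plane) {ι : Type*} (s : Finset ι) (f : ι → Plane) :
    det2 x (∑ i ∈ s, f i) = ∑ i ∈ s, det2 x (f i) := by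
  classical
  induction s using Finset.induction_on with
  | empty => simp [det2_zero_right]
  | insert a s ha ih => rw [Finset.sum_insert ha, Finset.sum_insert ha, det2_add_right, ih]

/-- The linear relation between three planar vectors. -/
lemma det2_cyclic (x y z : Plane) : det2 x y • z + det2 y z • x + det2 z x • y = 0 := by
  ext c
  fin_cases c <;> simp [det2] <;> ring

lemma continuous_det2_left (v : Plane) : Continuous fun x => det2 x v := by
  unfold det2; fun_prop

lemma continuous_det2_right (v : Plane) : Continuous fun x => det2 v x := by
  unfold det2; fun_prop

lemma convex_halfPlane (v : Plane) (r : ℝ) : Convex ℝ {x | det2 x v ≤ r} := by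
  intro x hx y hy s t hs ht hst
  simp only [mem_ofPred_eq, det2_add_left, det2_smul_left] at *
  calc s * det2 x v + t * det2 y v ≤ s * r + t * r := by gcongr
    _ = r := by rw [← add_mul, hst, one_mul]

lemma side_of_parallel_det {B Q : ℤ → Plane} {i : ℤ} {t : ℝ} (h : side Q i = t • side B i)
    (hB : det2 (B i) (B (i + 1)) ≠ 0) : sideRatio B Q i = t := by
  rw [sideRatio, h, det2_smul_right, side, det2_sub_right, det2_self, sub_zero]
  field_simp

/-! ### Centered balls and their duals -/

/-- A centered convex `2 * n`-gon, listed counterclockwise: both the vertices and the side vectors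
turn strictly counterclockwise, through a half turn in `n` steps. -/
structure IsBall (n : ℕ) (B : ℤ → Plane) : Prop where
  two_le : 2 ≤ n
  antiperiodic : ∀ i : ℤ, B (i + n) = -B i
  det_pos : ∀ i j : ℤ, i < j → j < i + n → 0 < det2 (B i) (B j)
  side_det_pos : ∀ i j : ℤ, i < j → j < i + n → 0 < det2 (side B i) (side B j)

namespace IsBall

variable {n : ℕ} {B : ℤ → Plane}

lemma det_succ_pos (hB : IsBall n B) (i : ℤ) : 0 < det2 (B i) (B (i + 1)) := by
  have := hB.two_le
  exact hB.det_pos _ _ (by lia) (by lia)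

lemma side_det_succ_pos (hB : IsBall n B) (i : ℤ) :
    0 < det2 (side B i) (side B (i + 1)) := by
  have := hB.two_le
  exact hB.side_det_pos _ _ (by lia) (by lia)

lemma side_antiperiodic (hB : IsBall n B) (i : ℤ) : side B (i + n) = -side B i := by
  rw [side, side, hB.antiperiodic, show i + n + 1 = i + 1 + n by ring, hB.antiperiodic]
  abel

lemma periodic (hB : IsBall n B) (i : ℤ) : B (i + 2 * n) = B i := by
  rw [show i + 2 * (n : ℤ) = i + n + n by ring, hB.antiperiodic, hB.antiperiodic, neg_neg]

lemma det_succ_periodic (hB : IsBall n B) (i : ℤ) :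
    det2 (B (i + n)) (B (i + n + 1)) = det2 (B i) (B (i + 1)) := by
  rw [show i + n + 1 = i + 1 + n by ring, hB.antiperiodic, hB.antiperiodic, det2_neg_left,
    det2_neg_right, neg_neg]

lemma side_eq (hB : IsBall n B) (i : ℤ) :
    side B i = det2 (B i) (B (i + 1)) • dualBall B i := by
  rw [dualBall, smul_smul, mul_one_div_cancel (hB.det_succ_pos i).ne', one_smul]

lemma det_dual (hB : IsBall n B) (i : ℤ) : det2 (B i) (dualBall B i) = 1 := by
  have := (hB.det_succ_pos i).ne'
  rw [dualBall, side, det2_smul_right, det2_sub_right, det2_self, sub_zero,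
    one_div_mul_cancel this]

lemma det_succ_dual (hB : IsBall n B) (i : ℤ) : det2 (B (i + 1)) (dualBall B i) = 1 := by
  have := (hB.det_succ_pos i).ne'
  rw [dualBall, side, det2_smul_right, det2_sub_right, det2_self, zero_sub, ← det2_swap,
    one_div_mul_cancel this]

lemma side_dual (hB : IsBall n B) (i : ℤ) :
    side (dualBall B) i = (-det2 (dualBall B i) (dualBall B (i + 1))) • B (i + 1) := by
  have h := det2_cyclic (dualBall B i) (dualBall B (i + 1)) (B (i + 1))
  rw [det2_swap (dualBall B (i + 1)), hB.det_dual, hB.det_succ_dual, one_smul, neg_one_smul] at h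
  rw [side, neg_smul, eq_neg_iff_add_eq_zero, ← h]
  abel

/-- The dual of a ball is a ball: its vertices are multiples of the sides of `B`, its sides negative
multiples of the vertices of `B`. -/
lemma dual (hB : IsBall n B) : IsBall n (dualBall B) := by
  have hpos : ∀ i j : ℤ, i < j → j < i + n → 0 < det2 (dualBall B i) (dualBall B j) := by
    intro i j hij hj
    rw [dualBall, dualBall, det2_smul_left, det2_smul_right]
    have := hB.side_det_pos i j hij hj
    have h1 := hB.det_succ_pos i
    have h2 := hB.det_succ_pos j
    positivity
  have hsucc : ∀ i : ℤ, 0 < det2 (dualBall B i) (dualBall B (i + 1)) := fun i =>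
    have := hB.two_le
    hpos _ _ (by lia) (by lia)
  refine ⟨hB.two_le, fun i => ?_, hpos, fun i j hij hj => ?_⟩
  · rw [dualBall, dualBall, hB.det_succ_periodic, hB.side_antiperiodic, smul_neg]
  · rw [hB.side_dual, hB.side_dual, det2_smul_left, det2_smul_right, neg_mul, neg_mul,
      mul_neg, neg_neg]
    have := hB.det_pos (i + 1) (j + 1) (by lia) (by lia)
    have h1 := hsucc i
    have h2 := hsucc j
    positivity

lemma dual_dual (hB : IsBall n B) (i : ℤ) : dualBall (dualBall B) i = -B (i + 1) := by
  have := (hB.dual.det_succ_pos i).ne'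
  rw [dualBall, hB.side_dual, smul_smul, mul_neg, one_div_mul_cancel this, neg_one_smul]

end IsBall

/-- The differences of the vertices of a polygon whose sides are positive multiples of directions
that turn counterclockwise by less than a half turn form positive determinants as well. -/
lemma det2_diff_pos {n : ℕ} {e B : ℤ → Plane} {u : ℤ → ℝ}
    (he : ∀ i j : ℤ, i < j → j < i + n → 0 < det2 (e i) (e j)) (hu : ∀ i, 0 < u i)
    (hB : ∀ i, side B i = u i • e i) {p q s : ℤ} (hpq : p < q) (hqs : q < s) (hs : s ≤ p + n) :
    0 < det2 (B q - B p) (B s - B q) := by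
  have hstep : ∀ r : ℤ, r < p + n → ∀ m : ℤ, p + 1 ≤ m → m ≤ r → 0 < det2 (B m - B p) (e r) := by
    intro r hr m hm
    induction m, hm using Int.leInduction with
    | base =>
      intro h
      rw [show B (p + 1) - B p = side B p from rfl, hB, det2_smul_left]
      exact mul_pos (hu _) (he _ _ (by lia) hr)
    | succ m hm ih =>
      intro h
      rw [show B (m + 1) - B p = side B m + (B m - B p) by rw [side]; abel, hB, det2_add_left,
        det2_smul_left]
      exact add_pos (mul_pos (hu _) (he _ _ (by lia) (by lia))) (ih (by lia))
  have hsum : ∀ m : ℤ, q + 1 ≤ m → m ≤ p + n → 0 < det2 (B q - B p) (B m - B q) := by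
    intro m hm
    induction m, hm using Int.leInduction with
    | base =>
      intro h
      rw [show B (q + 1) - B q = side B q from rfl, hB, det2_smul_right]
      exact mul_pos (hu _) (hstep _ (by lia) _ (by lia) le_rfl)
    | succ m hm ih =>
      intro h
      rw [show B (m + 1) - B q = side B m + (B m - B q) by rw [side]; abel, hB, det2_add_right,
        det2_smul_right]
      exact add_pos (mul_pos (hu _) (hstep _ (by lia) _ (by lia) (by lia))) (ih (by lia))
  exact hsum s (by lia) hs

/-- The vertices of a centered polygon turn with its sides: `[B i, B j]` is half of
`[B j - B i, B (i + n) - B j]`, hence positive. -/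
lemma isBall_of_directions {n : ℕ} {e B : ℤ → Plane} {u : ℤ → ℝ} (hn : 2 ≤ n)
    (hanti : ∀ i, B (i + n) = -B i)
    (he : ∀ i j : ℤ, i < j → j < i + n → 0 < det2 (e i) (e j)) (hu : ∀ i, 0 < u i)
    (hB : ∀ i, side B i = u i • e i) : IsBall n B := by
  refine ⟨hn, hanti, fun i j hij hj => ?_, fun i j hij hj => ?_⟩
  · have h := det2_diff_pos he hu hB hij hj le_rfl
    rw [hanti] at h
    simp only [det2_sub_left, det2_sub_right, det2_neg_right, det2_self] at h
    rw [det2_swap (B j) (B i)] at h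
    linarith
  · rw [hB, hB, det2_smul_left, det2_smul_right]
    exact mul_pos (hu _) (mul_pos (hu _) (he i j hij hj))

/-- A polygon adapted to a centered `2 * n`-gon `B`: it closes after `n` steps, and its sides are
parallel to those of `B`. -/
structure IsAdapted (n : ℕ) (B Q : ℤ → Plane) : Prop where
  periodic : ∀ i : ℤ, Q (i + n) = Q i
  parallel : ∀ i : ℤ, ∃ t : ℝ, side Q i = t • side B i

lemma IsConvexPolygonListing.isBall_unitBall {n : ℕ} {P : ℤ → Plane}
    (hP : IsConvexPolygonListing n P) {a : ℝ} (ha : 0 < a) : IsBall n (unitBall n a P) := by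
  obtain ⟨e, hanti, he, ht, hne⟩ := hP.directions
  choose t ht0 ht using ht
  have hpos : ∀ i, 0 < t i + t (i + n) := by
    intro i
    refine lt_of_le_of_ne (add_nonneg (ht0 _) (ht0 _)) fun h => ?_
    have h1 : t i = 0 := by linarith [ht0 i, ht0 (i + n)]
    have h2 : t (i + n) = 0 := by linarith [ht0 i, ht0 (i + n)]
    have := hne i
    simp [ht, h1, h2] at this
  refine isBall_of_directions (e := e) (u := fun i => 1 / (2 * a) * (t i + t (i + n)))
    hP.two_le (fun i => ?_) he (fun i => mul_pos (by positivity) (hpos i)) fun i => ?_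
  · rw [unitBall, unitBall, show i + n + n = i + 2 * (n : ℤ) by ring, hP.periodic, ← smul_neg,
      neg_sub]
  · have h1 := ht i
    have h2 := ht (i + n)
    rw [hanti] at h2
    have : side (unitBall n a P) i = (1 / (2 * a)) • (side P i - side P (i + n)) := by
      simp only [side, unitBall, show i + 1 + (n : ℤ) = i + n + 1 by ring]
      module
    rw [this, h1, h2]
    module

lemma IsConvexPolygonListing.isAdapted_centralEquidistant {n : ℕ} {P : ℤ → Plane}
    (hP : IsConvexPolygonListing n P) {a : ℝ} (ha : 0 < a) :
    IsAdapted n (unitBall n a P) (centralEquidistant n P) := by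
  have hU := hP.isBall_unitBall ha
  obtain ⟨e, hanti, he, ht, hne⟩ := hP.directions
  choose t ht0 ht using ht
  refine ⟨fun i => ?_, fun i => ?_⟩
  · rw [centralEquidistant, centralEquidistant, show i + n + n = i + 2 * (n : ℤ) by ring,
      hP.periodic, add_comm]
  · have h1 := ht i
    have h2 := ht (i + n)
    rw [hanti] at h2
    have hM : side (centralEquidistant n P) i = ((t i - t (i + n)) / 2) • e i := by
      have : side (centralEquidistant n P) i =
          (1 / 2 : ℝ) • (side P i + side P (i + n)) := by
        simp only [side, centralEquidistant, show i + 1 + (n : ℤ) = i + n + 1 by ring]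
        module
      rw [this, h1, h2]
      module
    have hB : side (unitBall n a P) i = ((t i + t (i + n)) / (2 * a)) • e i := by
      have : side (unitBall n a P) i = (1 / (2 * a)) • (side P i - side P (i + n)) := by
        simp only [side, unitBall, show i + 1 + (n : ℤ) = i + n + 1 by ring]
        module
      rw [this, h1, h2]
      module
    have hne : (t i + t (i + n)) / (2 * a) ≠ 0 := by
      intro h
      have h3 := hU.det_succ_pos i
      rw [show unitBall n a P (i + 1) = side (unitBall n a P) i + unitBall n a P i by
        rw [side]; abel, hB, h, zero_smul, zero_add, det2_self] at h3
      exact h3.false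
    refine ⟨((t i - t (i + n)) / 2) / ((t i + t (i + n)) / (2 * a)), ?_⟩
    rw [hM, hB, smul_smul, div_mul_cancel₀ _ hne]

/-! ### Involutes -/

namespace IsAdapted

variable {n : ℕ} {B Q : ℤ → Plane}

lemma side_eq (hB : IsBall n B) (hQ : IsAdapted n B Q) (i : ℤ) :
    side Q i = sideRatio B Q i • side B i := by
  obtain ⟨t, ht⟩ := hQ.parallel i
  rw [side_of_parallel_det ht (hB.det_succ_pos i).ne', ht]

lemma side_eq_dual (hB : IsBall n B) (hQ : IsAdapted n B Q) (i : ℤ) :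
    side Q i = (sideRatio B Q i * det2 (B i) (B (i + 1))) • dualBall B i := by
  rw [hQ.side_eq hB, hB.side_eq, smul_smul]

lemma side_periodic (hQ : IsAdapted n B Q) (i : ℤ) : side Q (i + n) = side Q i := by
  rw [side, side, hQ.periodic, show i + n + 1 = i + 1 + n by ring, hQ.periodic]

lemma sideRatio_antiperiodic (hB : IsBall n B) (hQ : IsAdapted n B Q) (i : ℤ) :
    sideRatio B Q (i + n) = -sideRatio B Q i := by
  rw [sideRatio, hB.det_succ_periodic, hB.antiperiodic, hQ.side_periodic, det2_neg_left, neg_div,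
    ← sideRatio]

lemma halfLength_antiperiodic (hB : IsBall n B) (hQ : IsAdapted n B Q) (i : ℤ) :
    halfLength n B Q (i + n) = -halfLength n B Q i := by
  rw [halfLength, halfLength, ← mul_neg, ← Finset.sum_neg_distrib]
  congr 1
  refine Finset.sum_congr rfl fun j _ => ?_
  rw [show i + n + (j : ℤ) = i + j + n by ring, hQ.sideRatio_antiperiodic hB,
    hB.det_succ_periodic, neg_mul]

/-- The radii of the involute change by the dual lengths of the sides of the evolute. -/
lemma halfLength_succ (hB : IsBall n B) (hQ : IsAdapted n B Q) (i : ℤ) :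
    halfLength n B Q (i + 1) =
      halfLength n B Q i - sideRatio B Q i * det2 (B i) (B (i + 1)) := by
  set f : ℤ → ℝ := fun j => sideRatio B Q j * det2 (B j) (B (j + 1)) with hf
  have h1 := Finset.sum_range_succ (fun j : ℕ => f (i + j)) n
  have h2 := Finset.sum_range_succ' (fun j : ℕ => f (i + j)) n
  have h3 : ∑ j ∈ Finset.range n, f (i + 1 + j) =
      ∑ j ∈ Finset.range n, f (i + ((j + 1 : ℕ) : ℤ)) := by
    refine Finset.sum_congr rfl fun j _ => ?_
    congr 1
    push_cast
    ring
  have h4 : f (i + n) = -f i := by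
    simp only [hf]
    rw [hQ.sideRatio_antiperiodic hB, hB.det_succ_periodic, neg_mul]
  have h5 : halfLength n B Q (i + 1) = 1 / 2 * ∑ j ∈ Finset.range n, f (i + 1 + j) := rfl
  have h6 : halfLength n B Q i = 1 / 2 * ∑ j ∈ Finset.range n, f (i + j) := rfl
  rw [Nat.cast_zero, add_zero] at h2
  rw [h5, h6, h3]
  change _ = _ - f i
  linarith

lemma side_involute (hB : IsBall n B) (hQ : IsAdapted n B Q) (i : ℤ) :
    side (involute n B Q) i = halfLength n B Q (i + 1) • side (dualBall B) i := by
  have h1 := hQ.side_eq_dual hB i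
  have h2 := hQ.halfLength_succ hB i
  have : side (involute n B Q) i = side Q i + halfLength n B Q (i + 1) • dualBall B (i + 1)
      - halfLength n B Q i • dualBall B i := by
    simp only [side, involute]
    abel
  rw [this, h1, h2, side]
  module

/-- The evolute of the involute is the original polygon. -/
lemma involute_sub (hB : IsBall n B) (hQ : IsAdapted n B Q) (i : ℤ) :
    involute n B Q i - halfLength n B Q (i + 1) • dualBall B i = Q (i + 1) := by
  have h1 := hQ.side_eq_dual hB i
  have h2 := hQ.halfLength_succ hB i
  rw [show Q (i + 1) = Q i + side Q i by rw [side]; abel, h1, h2, involute]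
  module

lemma isAdapted_involute (hB : IsBall n B) (hQ : IsAdapted n B Q) :
    IsAdapted n (dualBall B) (involute n B Q) := by
  refine ⟨fun i => ?_, fun i => ⟨_, hQ.side_involute hB i⟩⟩
  rw [involute, involute, hQ.periodic, hQ.halfLength_antiperiodic hB, hB.dual.antiperiodic,
    neg_smul_neg]

lemma isCentralInvolute (hB : IsBall n B) (hQ : IsAdapted n B Q) :
    IsCentralInvolute n (dualBall B) (fun i => Q (i + 1)) (involute n B Q) := by
  refine ⟨fun i => ⟨halfLength n B Q (i + 1), hQ.side_involute hB i,
    (hQ.involute_sub hB i).symm, ?_⟩, (hQ.isAdapted_involute hB).periodic⟩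
  simp [involute]

lemma sideRatio_involute (hB : IsBall n B) (hQ : IsAdapted n B Q) (i : ℤ) :
    sideRatio (dualBall B) (involute n B Q) i = halfLength n B Q (i + 1) :=
  side_of_parallel_det (hQ.side_involute hB i) (hB.dual.det_succ_pos i).ne'

end IsAdapted

/-! ### Constant width -/

namespace IsBall

variable {n : ℕ} {B : ℤ → Plane}

lemma exists_forall_le (hB : IsBall n B) (v : Plane) :
    ∃ j : ℤ, ∀ i : ℤ, det2 (B i) v ≤ det2 (B j) v := by
  have hn : (0 : ℤ) < 2 * n := by have := hB.two_le; lia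
  obtain ⟨j, -, hj⟩ := (Finset.Ico (0 : ℤ) (0 + 2 * n)).exists_max_image
    (fun i => det2 (B i) v) ⟨0, by simpa using hn⟩
  refine ⟨j, fun i => ?_⟩
  have hper : Function.Periodic (fun i => det2 (B i) v) (2 * n : ℤ) := fun i => by
    simp only [hB.periodic]
  obtain ⟨k, hk, hik⟩ := hper.exists_mem_Ico hn i 0
  rw [hik]
  exact hj k (by simpa using hk)

/-- After a vertex that is extreme in a direction, the polygon descends for half a turn: the side
vectors in between lie in the cone spanned by the first and the last of them. -/
lemma side_nonpos_of_max (hB : IsBall n B) {v : Plane} {j : ℤ}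
    (hj : ∀ i : ℤ, det2 (B i) v ≤ det2 (B j) v) {i : ℤ} (hji : j ≤ i) (hi : i < j + n) :
    det2 (side B i) v ≤ 0 := by
  have h1 : det2 (side B j) v ≤ 0 := by
    rw [side, det2_sub_left]
    linarith [hj (j + 1)]
  have h2 : det2 (side B (j + n - 1)) v ≤ 0 := by
    rw [show j + (n : ℤ) - 1 = j - 1 + n by ring, hB.side_antiperiodic, side, det2_neg_left,
      det2_sub_left, sub_add_cancel]
    linarith [hj (j - 1)]
  rcases hji.eq_or_lt with rfl | hji
  · exact h1
  rcases (show i ≤ j + n - 1 by lia).eq_or_lt with rfl | hi'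
  · exact h2
  have h := congrArg (fun x => det2 x v)
    (det2_cyclic (side B j) (side B i) (side B (j + n - 1)))
  simp only [det2_add_left, det2_smul_left] at h
  rw [det2_swap (side B (j + n - 1)) (side B j), det2_zero_left] at h
  have h3 := hB.side_det_pos j i hji hi
  have h4 := hB.side_det_pos i (j + n - 1) hi' (by lia)
  have h5 := hB.side_det_pos j (j + n - 1) (by lia) (by lia)
  by_contra! hpos
  nlinarith [mul_pos h5 hpos, mul_nonneg h4.le (neg_nonneg.2 h1),
    mul_nonneg h3.le (neg_nonneg.2 h2)]

/-- A polygon whose sides are nonnegative multiples of those of a ball is extreme at the same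
vertices as the ball. -/
lemma max_of_max (hB : IsBall n B) {Q : ℤ → Plane} (hper : ∀ i : ℤ, Q (i + 2 * n) = Q i)
    (hQ : ∀ i : ℤ, ∃ t : ℝ, 0 ≤ t ∧ side Q i = t • side B i) {v : Plane} {j : ℤ}
    (hj : ∀ i : ℤ, det2 (B i) v ≤ det2 (B j) v) (i : ℤ) :
    det2 (Q i) v ≤ det2 (Q j) v := by
  choose t ht0 ht using hQ
  have hn : (0 : ℤ) < 2 * n := by have := hB.two_le; lia
  have hstep : ∀ i, det2 (Q (i + 1)) v = det2 (Q i) v + t i * det2 (side B i) v := by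
    intro i
    rw [← det2_smul_left, ← ht, side, det2_sub_left]
    ring
  have hright : ∀ m : ℕ, m ≤ n → det2 (Q (j + m)) v ≤ det2 (Q j) v := by
    intro m
    induction m with
    | zero => simp
    | succ m ih =>
      intro hm
      have h1 := hB.side_nonpos_of_max hj (i := j + m) (by lia) (by lia)
      have h2 := hstep (j + m)
      rw [Nat.cast_succ, ← add_assoc, h2]
      nlinarith [ih (by lia), mul_nonneg (ht0 (j + m)) (neg_nonneg.2 h1)]
  have hleft : ∀ m : ℕ, m ≤ n → det2 (Q (j - m)) v ≤ det2 (Q j) v := by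
    intro m
    induction m with
    | zero => simp
    | succ m ih =>
      intro hm
      have h1 := hB.side_nonpos_of_max hj (i := j - (m + 1) + n) (by lia) (by lia)
      have h2 := hstep (j - (m + 1))
      rw [hB.side_antiperiodic, det2_neg_left] at h1
      rw [show j - ((m : ℤ) + 1) + 1 = j - m by ring] at h2
      rw [Nat.cast_succ]
      nlinarith [ih (by lia), mul_nonneg (ht0 (j - (m + 1))) (neg_nonpos.1 h1)]
  have hp : Function.Periodic (fun i => det2 (Q i) v) (2 * n : ℤ) := fun i => by
    simp only [hper]
  obtain ⟨k, hk, hik⟩ := hp.exists_mem_Ico hn i (j - n)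
  rw [hik]
  rcases le_total j k with h | h
  · have := hright (k - j).toNat (by have := hk.2; lia)
    rwa [Int.toNat_of_nonneg (by lia), add_sub_cancel] at this
  · have := hleft (j - k).toNat (by have := hk.1; lia)
    rwa [Int.toNat_of_nonneg (by lia), sub_sub_cancel] at this

end IsBall

lemma supportFn_convexHull_range {Q : ℤ → Plane} {v : Plane} {j : ℤ}
    (hj : ∀ i : ℤ, det2 (Q i) v ≤ det2 (Q j) v) :
    supportFn (convexHull ℝ (range Q)) v = det2 (Q j) v := by
  refine IsGreatest.csSup_eq ⟨⟨Q j, subset_convexHull ℝ _ ⟨j, rfl⟩, rfl⟩, ?_⟩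
  rintro _ ⟨x, hx, rfl⟩
  refine convexHull_min ?_ (convex_halfPlane v (det2 (Q j) v)) hx
  rintro _ ⟨i, rfl⟩
  exact hj i

/-- An equidistant `Q + c B` with nonnegative side ratios is extreme in the directions `v`, `-v` at
the vertices `j`, `j + n`, if `B` is extreme there; as `Q j = Q (j + n)`, only `c B` contributes to
the width. -/
lemma IsAdapted.hasConstantWidth {n : ℕ} {B Q : ℤ → Plane} (hB : IsBall n B)
    (hQ : IsAdapted n B Q) : HasConstantWidth n B Q := by
  have hn : (0 : ℤ) < n := by have := hB.two_le; lia
  refine ⟨hQ.parallel, ⟨0, fun i => by rw [hQ.periodic, sub_self, zero_smul]⟩,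
    ∑ j ∈ Finset.Ico (0 : ℤ) (0 + n), |sideRatio B Q j|, fun c hc => ?_⟩
  have hle : ∀ i, |sideRatio B Q i| ≤ c := by
    intro i
    have hper : Function.Periodic (fun i => |sideRatio B Q i|) (n : ℤ) := fun i => by
      simp only [hQ.sideRatio_antiperiodic hB, abs_neg]
    obtain ⟨k, hk, hik⟩ := hper.exists_mem_Ico hn i 0
    rw [hik]
    exact (Finset.single_le_sum (f := fun j => |sideRatio B Q j|) (fun _ _ => abs_nonneg _)
      (Finset.mem_Ico.2 hk)).trans hc
  have hside : ∀ i : ℤ, ∃ t : ℝ, 0 ≤ t ∧ side (fun j => Q j + c • B j) i = t • side B i := by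
    intro i
    refine ⟨sideRatio B Q i + c, by linarith [neg_abs_le (sideRatio B Q i), hle i], ?_⟩
    rw [add_smul, ← hQ.side_eq hB]
    simp only [side]
    module
  -- `h(B)(v) = 1` makes the width `2 * c`
  refine ⟨hside, 2 * c, fun v hv => ?_⟩
  have hper : ∀ i : ℤ, Q (i + 2 * n) + c • B (i + 2 * n) = Q i + c • B i := by
    intro i
    rw [hB.periodic, show i + 2 * (n : ℤ) = i + n + n by ring, hQ.periodic, hQ.periodic]
  obtain ⟨j, hj⟩ := hB.exists_forall_le v
  have hj' : ∀ i, det2 (B i) (-v) ≤ det2 (B (j + n)) (-v) := by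
    intro i
    have := hj (i + n)
    rw [hB.antiperiodic, det2_neg_left] at this
    rwa [hB.antiperiodic, det2_neg_right, det2_neg_right, det2_neg_left, neg_neg]
  rw [supportFn_convexHull_range hj] at hv
  rw [supportFn_convexHull_range (hB.max_of_max hper hside hj),
    supportFn_convexHull_range (hB.max_of_max hper hside hj'), hB.antiperiodic, hQ.periodic]
  simp only [det2_add_left, det2_smul_left, det2_neg_right, det2_neg_left, hv]
  ring

/-! ### Points that see a polygon under a single tangent -/

/-- The signed height of the point `x` over the line of the `i`-th side of `Q`, in the direction
of the side of `B`. -/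
def sideHeight (B Q : ℤ → Plane) (x : Plane) (i : ℤ) : ℝ := det2 (x - Q i) (side B i)

/-- Over some half turn the point `x` lies on the positive side of all side lines of `Q`, the two
ends of the half turn (which carry the same line) excepted. Off the polygon this
says that the heights change their sign only once in `n` steps, that is, exactly one tangent of `Q`
passes through `x`. -/
def HasUniqueTangent (n : ℕ) (B Q : ℤ → Plane) (x : Plane) : Prop :=
  ∃ j : ℤ, ∀ i ∈ Ioo j (j + n), 0 < sideHeight B Q x i

lemma continuous_sideHeight (B Q : ℤ → Plane) (i : ℤ) :
    Continuous fun x => sideHeight B Q x i :=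
  (continuous_det2_left _).comp (continuous_id.sub continuous_const)

lemma isOpen_hasUniqueTangent (n : ℕ) (B Q : ℤ → Plane) :
    IsOpen {x | HasUniqueTangent n B Q x} := by
  have : {x | HasUniqueTangent n B Q x} =
      ⋃ j : ℤ, ⋂ i ∈ Ioo j (j + n), {x | 0 < sideHeight B Q x i} := by
    ext x
    simp [HasUniqueTangent]
  rw [this]
  exact isOpen_iUnion fun j => (finite_Ioo _ _).isOpen_biInter fun i _ =>
    isOpen_lt continuous_const (continuous_sideHeight B Q i)

namespace IsAdapted

variable {n : ℕ} {B Q : ℤ → Plane}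

lemma sideHeight_antiperiodic (hB : IsBall n B) (hQ : IsAdapted n B Q) (x : Plane) (i : ℤ) :
    sideHeight B Q x (i + n) = -sideHeight B Q x i := by
  rw [sideHeight, sideHeight, hQ.periodic, hB.side_antiperiodic, det2_neg_right]

/-- The heights may be taken over either end of a side. -/
lemma sideHeight_eq_succ (hQ : IsAdapted n B Q) (x : Plane) (i : ℤ) :
    sideHeight B Q x i = det2 (x - Q (i + 1)) (side B i) := by
  obtain ⟨t, ht⟩ := hQ.parallel i
  rw [show Q (i + 1) = Q i + side Q i by rw [side]; abel, ht, sideHeight]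
  simp only [det2_sub_left, det2_add_left, det2_smul_left, det2_self]
  ring

/-- The strict inequalities over an open half turn imply weak ones over a half-open one, which are
preserved in limits. -/
lemma weak_of_hasUniqueTangent (hB : IsBall n B) (hQ : IsAdapted n B Q) {x : Plane}
    (hx : HasUniqueTangent n B Q x) : ∃ j : ℤ, ∀ i ∈ Ico j (j + n), 0 ≤ sideHeight B Q x i := by
  obtain ⟨j, hj⟩ := hx
  rcases le_or_gt 0 (sideHeight B Q x j) with h | h
  · refine ⟨j, fun i hi => ?_⟩
    rcases hi.1.eq_or_lt with rfl | hji
    · exact h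
    · exact (hj i ⟨hji, hi.2⟩).le
  · refine ⟨j + 1, fun i hi => ?_⟩
    obtain ⟨h1, h2⟩ := hi
    rcases (show i ≤ j + n by lia).eq_or_lt with rfl | hin
    · rw [hQ.sideHeight_antiperiodic hB]
      linarith
    · exact (hj i ⟨by lia, hin⟩).le

/-- A point on the line of a side, but not on the side itself, is on opposite sides of the two
neighbouring side lines. -/
lemma mul_neg_of_sideHeight_eq_zero (hB : IsBall n B) (hQ : IsAdapted n B Q) {x : Plane}
    (hx : x ∉ polyCurve Q) {i : ℤ} (h : sideHeight B Q x i = 0) :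
    sideHeight B Q x (i - 1) * sideHeight B Q x (i + 1) < 0 := by
  obtain ⟨t, ht⟩ := hQ.parallel i
  have hw := hB.side_det_succ_pos i
  have hw' := hB.side_det_succ_pos (i - 1)
  rw [sub_add_cancel] at hw'
  -- the position of `x` on the side line
  obtain ⟨s, hs⟩ : ∃ s : ℝ, x - Q i = s • side B i := by
    have h1 := det2_cyclic (x - Q i) (side B i) (side B (i + 1))
    rw [show det2 (x - Q i) (side B i) = 0 from h, zero_smul, zero_add] at h1
    refine ⟨-det2 (side B (i + 1)) (x - Q i) / det2 (side B i) (side B (i + 1)), ?_⟩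
    rw [div_eq_inv_mul, mul_smul, neg_smul, ← eq_neg_of_add_eq_zero_left h1, smul_smul,
      inv_mul_cancel₀ hw.ne', one_smul]
  have hx1 : x - Q (i + 1) = (s - t) • side B i := by
    rw [sub_smul, ← hs, ← ht, side]
    abel
  have hst : 0 < s * (s - t) := by
    by_contra! hle
    refine hx (mem_iUnion.2 ⟨i, ?_⟩)
    have hx2 : x = Q i + s • side B i := by rw [← hs]; abel
    have hQ2 : Q (i + 1) = Q i + t • side B i := by rw [← ht, side]; abel
    rcases eq_or_ne t 0 with rfl | htne
    · have : s = 0 := by nlinarith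
      rw [hx2, this, zero_smul, add_zero]
      exact left_mem_segment ℝ _ _
    · rw [segment_eq_image']
      have ht2 : 0 < t ^ 2 := by positivity
      refine ⟨s / t, ⟨?_, ?_⟩, ?_⟩
      · rw [show s / t = s * t / t ^ 2 by field_simp]
        have : 0 ≤ s * t := by nlinarith [sq_nonneg s]
        positivity
      · rw [show s / t = s * t / t ^ 2 by field_simp, div_le_one ht2]
        nlinarith [sq_nonneg (s - t)]
      · change Q i + (s / t) • (Q (i + 1) - Q i) = x
        rw [hQ2, add_sub_cancel_left, smul_smul, div_mul_cancel₀ _ htne, hx2]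
  rw [hQ.sideHeight_eq_succ x (i - 1), sub_add_cancel, hs, sideHeight, hx1, det2_smul_left,
    det2_smul_left, det2_swap (side B i) (side B (i - 1))]
  nlinarith [mul_pos hst (mul_pos hw hw')]

/-- Off the polygon the zeros among the heights separate heights of opposite signs, so that weak
inequalities over a half turn can fail to be strict only at its ends. -/
lemma hasUniqueTangent_of_weak (hB : IsBall n B) (hQ : IsAdapted n B Q) {x : Plane}
    (hx : x ∉ polyCurve Q) {j : ℤ} (hj : ∀ i ∈ Ico j (j + n), 0 ≤ sideHeight B Q x i) :
    HasUniqueTangent n B Q x := by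
  have hn := hB.two_le
  have hlt : ∀ i ∈ Ioo j (j + n - 1), 0 < sideHeight B Q x i := by
    intro i hi
    obtain ⟨h1, h2⟩ := hi
    refine lt_of_le_of_ne (hj i ⟨h1.le, by lia⟩) fun h => ?_
    have := hQ.mul_neg_of_sideHeight_eq_zero hB hx h.symm
    exact this.not_ge (mul_nonneg (hj _ ⟨by lia, by lia⟩) (hj _ ⟨by lia, by lia⟩))
  have hlast := hj (j + n - 1) ⟨by lia, by lia⟩
  rcases hlast.eq_or_lt with h | h
  · -- a zero at the last side forces the first height to be nonzero
    have hne := hQ.mul_neg_of_sideHeight_eq_zero hB hx h.symm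
    rw [sub_add_cancel, hQ.sideHeight_antiperiodic hB] at hne
    refine ⟨j - 1, fun i hi => ?_⟩
    obtain ⟨h1, h2⟩ := hi
    rcases (show j ≤ i by lia).eq_or_lt with rfl | hji
    · refine lt_of_le_of_ne (hj j ⟨le_rfl, by lia⟩) fun h0 => ?_
      rw [← h0] at hne
      simp at hne
    · exact hlt i ⟨hji, by lia⟩
  · refine ⟨j, fun i hi => ?_⟩
    obtain ⟨h1, h2⟩ := hi
    rcases (show i ≤ j + n - 1 by lia).eq_or_lt with rfl | hin
    · exact h
    · exact hlt i ⟨h1, hin⟩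

/-- Off the polygon, having a unique tangent is also a closed condition. -/
lemma closure_hasUniqueTangent_inter (hB : IsBall n B) (hQ : IsAdapted n B Q) :
    closure {x | HasUniqueTangent n B Q x} ∩ (polyCurve Q)ᶜ ⊆ {x | HasUniqueTangent n B Q x} := by
  have hn : (0 : ℤ) < 2 * n := by have := hB.two_le; lia
  have hclosed : IsClosed (⋃ j ∈ Ico (0 : ℤ) (0 + 2 * n),
      ⋂ i ∈ Ico j (j + n), {x | 0 ≤ sideHeight B Q x i}) :=
    (finite_Ico _ _).isClosed_biUnion fun j _ => isClosed_biInter fun i _ =>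
      isClosed_le continuous_const (continuous_sideHeight B Q i)
  rintro x ⟨hx, hxQ⟩
  have hsub : {x | HasUniqueTangent n B Q x} ⊆ ⋃ j ∈ Ico (0 : ℤ) (0 + 2 * n),
      ⋂ i ∈ Ico j (j + n), {x | 0 ≤ sideHeight B Q x i} := by
    intro y hy
    obtain ⟨j, hj⟩ := hQ.weak_of_hasUniqueTangent hB hy
    have hper2 : ∀ i, sideHeight B Q y (i + 2 * n) = sideHeight B Q y i := by
      intro i
      rw [show i + 2 * (n : ℤ) = i + n + n by ring, hQ.sideHeight_antiperiodic hB,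
        hQ.sideHeight_antiperiodic hB, neg_neg]
    have hper : Function.Periodic (fun j : ℤ => ∀ i ∈ Ico j (j + n), 0 ≤ sideHeight B Q y i)
        (2 * n : ℤ) := by
      intro j
      refine propext ⟨fun h i hi => ?_, fun h i hi => ?_⟩
      · rw [← hper2]
        exact h _ ⟨by have := hi.1; lia, by have := hi.2; lia⟩
      · rw [← sub_add_cancel i (2 * n : ℤ), hper2]
        exact h _ ⟨by have := hi.1; lia, by have := hi.2; lia⟩
    obtain ⟨k, hk, hjk⟩ := hper.exists_mem_Ico hn j 0
    have hk' := hjk.mp hj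
    simp only [mem_iUnion]
    exact ⟨k, hk, mem_iInter₂.2 hk'⟩
  have hx' := closure_minimal hsub hclosed hx
  simp only [mem_iUnion] at hx'
  obtain ⟨j, -, hj⟩ := hx'
  exact hQ.hasUniqueTangent_of_weak hB hxQ (mem_iInter₂.1 hj)

end IsAdapted

namespace IsAdapted

variable {n : ℕ} {B Q : ℤ → Plane}

/-- Seen from far away the polygon looks like a point, and there is only one line through two
points. -/
lemma hasUniqueTangent_of_norm_gt (hB : IsBall n B) (hQ : IsAdapted n B Q) :
    ∃ R : ℝ, ∀ y : Plane, R < ‖y‖ → HasUniqueTangent n B Q y := by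
  have hn : (0 : ℤ) < n := by have := hB.two_le; lia
  -- away from the origin, the polygon that consists of the origin only has a unique tangent
  have hzero : ∀ y : Plane, y ≠ 0 → ∃ j : ℤ, ∀ i ∈ Ioo j (j + n), 0 < det2 y (side B i) := by
    intro y hy
    have h0 : IsAdapted n B fun _ => 0 := ⟨fun _ => rfl, fun i => ⟨0, by simp [side]⟩⟩
    obtain ⟨j, hj⟩ := hB.exists_forall_le y
    have hmem : y ∉ polyCurve fun _ => (0 : Plane) := by simpa [polyCurve] using hy
    have := h0.hasUniqueTangent_of_weak hB hmem (j := j) fun i hi => by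
      have := hB.side_nonpos_of_max hj hi.1 hi.2
      rw [det2_swap] at this
      simpa [sideHeight] using this
    simpa [HasUniqueTangent, sideHeight] using this
  -- by compactness, the heights are bounded below on the unit circle
  obtain ⟨m, hm⟩ := (isCompact_sphere (0 : Plane) 1).elim_directed_cover
    (fun m : ℕ => ⋃ j : ℤ, ⋂ i ∈ Ioo j (j + n),
      {y : Plane | 1 / ((m : ℝ) + 1) < det2 y (side B i)})
    (fun m => isOpen_iUnion fun j => (finite_Ioo _ _).isOpen_biInter fun i _ =>
      isOpen_lt continuous_const (continuous_det2_left _))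
    (by
      intro y hy
      obtain ⟨j, hj⟩ := hzero y (by rintro rfl; simp at hy)
      have hev : ∀ᶠ m : ℕ in atTop, ∀ i ∈ Ioo j (j + n),
          1 / ((m : ℝ) + 1) < det2 y (side B i) :=
        (finite_Ioo _ _).eventually_all.2 fun i hi =>
          tendsto_one_div_add_atTop_nhds_zero_nat.eventually_lt_const (hj i hi)
      obtain ⟨m, hm⟩ := hev.exists
      exact mem_iUnion.2 ⟨m, mem_iUnion.2 ⟨j, mem_iInter₂.2 hm⟩⟩)
    (by
      refine Monotone.directed_le (f := fun m : ℕ => ⋃ j : ℤ, ⋂ i ∈ Ioo j (j + n),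
        {y : Plane | 1 / ((m : ℝ) + 1) < det2 y (side B i)}) fun m m' hmm => ?_
      refine iUnion_mono fun j => iInter₂_mono fun i _ y hy => ?_
      have hle : 1 / ((m' : ℝ) + 1) ≤ 1 / ((m : ℝ) + 1) :=
        one_div_le_one_div_of_le (by positivity) (by exact_mod_cast Nat.add_le_add_right hmm 1)
      exact lt_of_le_of_lt hle hy)
  set C : ℝ := ∑ i ∈ Finset.Ico (0 : ℤ) (0 + n), |det2 (Q i) (side B i)| with hC
  have hC0 : 0 ≤ C := Finset.sum_nonneg fun _ _ => abs_nonneg _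
  have hle : ∀ i, |det2 (Q i) (side B i)| ≤ C := by
    intro i
    have hper : Function.Periodic (fun i => |det2 (Q i) (side B i)|) (n : ℤ) := fun i => by
      simp only [hQ.periodic, hB.side_antiperiodic, det2_neg_right, abs_neg]
    obtain ⟨k, hk, hik⟩ := hper.exists_mem_Ico hn i 0
    rw [hik]
    exact Finset.single_le_sum (f := fun i => |det2 (Q i) (side B i)|)
      (fun _ _ => abs_nonneg _) (Finset.mem_Ico.2 hk)
  refine ⟨C * (m + 1), fun y hy => ?_⟩
  have hy0 : 0 < ‖y‖ := lt_of_le_of_lt (by positivity) hy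
  have hyS : ‖y‖⁻¹ • y ∈ Metric.sphere (0 : Plane) 1 := by
    rw [mem_sphere_zero_iff_norm, norm_smul, norm_inv, norm_norm, inv_mul_cancel₀ hy0.ne']
  obtain ⟨j, hj⟩ := mem_iUnion.1 (hm hyS)
  refine ⟨j, fun i hi => ?_⟩
  have h1 : 1 / ((m : ℝ) + 1) < det2 (‖y‖⁻¹ • y) (side B i) := mem_iInter₂.1 hj i hi
  rw [det2_smul_left, div_lt_iff₀ (by positivity), mul_assoc, inv_mul_eq_div, lt_div_iff₀ hy0,
    one_mul] at h1
  have h2 : C < det2 y (side B i) := by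
    have : (0 : ℝ) < m + 1 := by positivity
    nlinarith
  rw [sideHeight, det2_sub_left]
  linarith [le_abs_self (det2 (Q i) (side B i)), hle i]

/-- No point of the involute has a unique tangent to `Q`. The signed distances of the side lines
of the involute from the point change, from one side to the next, by the heights over the sides of
`Q`; so they are monotone over a half turn, and a zero has to be at its ends, where
the heights have equal signs, contrary to the position between two vertices. -/
lemma notMem_polyCurve_involute (hB : IsBall n B) (hQ : IsAdapted n B Q) {x : Plane}
    (hx : HasUniqueTangent n B Q x) : x ∉ polyCurve (involute n B Q) := by
  have hn := hB.two_le
  set N := involute n B Q with hN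
  obtain ⟨j, hj⟩ := hx
  intro hmem
  obtain ⟨i₀, hi₀⟩ := mem_iUnion.1 hmem
  have hNper : ∀ i, N (i + n) = N i := (hQ.isAdapted_involute hB).periodic
  have hper : Function.Periodic (fun i => x ∈ segment ℝ (N i) (N (i + 1))) (n : ℤ) := fun i => by
    simp only [show i + (n : ℤ) + 1 = i + 1 + n by ring, hNper]
  obtain ⟨i, ⟨hji, hij⟩, hii⟩ := hper.exists_mem_Ico (by lia) i₀ j
  have hi : x ∈ segment ℝ (N i) (N (i + 1)) := hii.mp hi₀
  clear hii hi₀ hmem i₀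
  have hside : ∀ i, ∃ c : ℝ, N (i + 1) = N i + c • B (i + 1) := by
    intro i
    have h := hQ.side_involute hB i
    rw [hB.side_dual, smul_smul] at h
    exact ⟨_, by rw [← h, side]; abel⟩
  have hNQ : ∀ i, sideHeight B Q x i = det2 (x - N i) (side B i) := by
    intro i
    rw [sideHeight, hB.side_eq, hN, involute]
    simp only [det2_sub_left, det2_add_left, det2_smul_left, det2_smul_right, det2_self]
    ring
  set h : ℤ → ℝ := fun i => det2 (N i - x) (B (i + 1)) with hh
  have hanti : ∀ i, h (i + n) = -h i := by
    intro i
    simp only [hh]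
    rw [hNper, show i + (n : ℤ) + 1 = i + 1 + n by ring, hB.antiperiodic, det2_neg_right]
  have hstep : ∀ i, h (i + 1) = h i - sideHeight B Q x (i + 1) := by
    intro i
    obtain ⟨c, hc⟩ := hside i
    simp only [hh]
    rw [hNQ, hc, side]
    simp only [det2_sub_left, det2_add_left, det2_smul_left, det2_sub_right, det2_self]
    ring
  have hdec : ∀ m : ℕ, 1 ≤ m → m < n → h (j + m) < h j := by
    intro m hm
    induction m, hm using Nat.le_induction with
    | base =>
      intro hmn
      have := hj (j + 1) ⟨by lia, by lia⟩
      have h2 := hstep j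
      push_cast
      linarith
    | succ m hm ih =>
      intro hmn
      have := hj (j + m + 1) ⟨by lia, by lia⟩
      have h2 := hstep (j + m)
      have h3 := ih (by lia)
      push_cast
      rw [← add_assoc]
      linarith
  have hlast : h (j + n - 1) < h j := by
    have := hdec (n - 1) (by lia) (by lia)
    rwa [Nat.cast_sub (by lia), Nat.cast_one, ← add_sub_assoc] at this
  have hend : h (j + n) = h (j + n - 1) - sideHeight B Q x (j + n) := by
    have := hstep (j + n - 1)
    rwa [sub_add_cancel] at this
  have hend' := hanti j
  have hend'' := hQ.sideHeight_antiperiodic hB x j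
  -- the position of `x` on its side of the involute
  obtain ⟨hi0, hprod⟩ : h i = 0 ∧ sideHeight B Q x i * sideHeight B Q x (i + 1) ≤ 0 := by
    rw [segment_eq_image'] at hi
    obtain ⟨s, ⟨hs0, hs1⟩, rfl⟩ := hi
    obtain ⟨c, hc⟩ := hside i
    rw [hNQ, hNQ]
    simp only [hh]
    rw [hc]
    have e1 : N i - (N i + s • (N i + c • B (i + 1) - N i)) = (-(s * c)) • B (i + 1) := by
      module
    have e2 : N i + s • (N i + c • B (i + 1) - N i) - N i = (s * c) • B (i + 1) := by
      module
    have e3 : N i + s • (N i + c • B (i + 1) - N i) - (N i + c • B (i + 1)) =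
        (-((1 - s) * c)) • B (i + 1) := by
      module
    rw [e1, e2, e3, det2_smul_left, det2_smul_left, det2_smul_left, side, side, det2_sub_right,
      det2_sub_right, det2_self, det2_swap (B (i + 1)) (B i)]
    refine ⟨by ring, ?_⟩
    have h1 := hB.det_succ_pos i
    have h2 := hB.det_succ_pos (i + 1)
    have h3 : 0 ≤ (s * (1 - s)) * (c ^ 2 * (det2 (B i) (B (i + 1)) *
        det2 (B (i + 1)) (B (i + 1 + 1)))) := by
      have : 0 ≤ 1 - s := by linarith
      positivity
    linarith
  rcases hji.eq_or_lt with rfl | hji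
  · have h1 := hj (j + 1) ⟨by lia, by lia⟩
    have h2 : 0 < sideHeight B Q x j := by linarith
    linarith [mul_pos h2 h1]
  · have h1 := hj i ⟨hji, hij⟩
    rcases (show i + 1 ≤ j + n by lia).eq_or_lt with h2 | h2
    · have h3 : i = j + n - 1 := by lia
      subst h3
      rw [h2] at hprod
      have h4 : 0 < sideHeight B Q x (j + n) := by linarith
      linarith [mul_pos h1 h4]
    · linarith [mul_pos h1 (hj (i + 1) ⟨by lia, h2⟩)]

/-- The component of an exterior point of `Q` in the complement of `Q` contains points far away, so
all of its points have a unique tangent and none of them lies on the involute: paths to infinity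
off `Q` avoid the involute as well. -/
lemma polyRegion_involute_subset (hB : IsBall n B) (hQ : IsAdapted n B Q) :
    polyRegion (involute n B Q) ⊆ polyRegion Q := by
  refine compl_subset_compl.2 ?_
  rintro x ⟨hx, hunb⟩
  have hconn := isPathConnected_pathComponentIn (F := (polyCurve Q)ᶜ) hx
  have hsub : pathComponentIn (polyCurve Q)ᶜ x ⊆ {y | HasUniqueTangent n B Q y} := by
    refine hconn.isConnected.isPreconnected.subset_of_closure_inter_subset
      (isOpen_hasUniqueTangent n B Q) ?_ fun y hy =>
      hQ.closure_hasUniqueTangent_inter hB ⟨hy.1, pathComponentIn_subset hy.2⟩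
    obtain ⟨R, hR⟩ := hQ.hasUniqueTangent_of_norm_gt hB
    by_contra hempty
    refine hunb (isBounded_iff_forall_norm_le.2 ⟨R, fun y hy => ?_⟩)
    by_contra! hlt
    exact hempty ⟨y, hy, hR y hlt⟩
  have hsub' : pathComponentIn (polyCurve Q)ᶜ x ⊆ (polyCurve (involute n B Q))ᶜ :=
    fun y hy => hQ.notMem_polyCurve_involute hB (hsub hy)
  have hxx : x ∈ pathComponentIn (polyCurve Q)ᶜ x := mem_pathComponentIn_self hx
  refine ⟨hsub' hxx, fun hb => hunb (hb.subset fun y hy => ?_)⟩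
  exact (hconn.joinedIn x hxx y hy).mono hsub'

end IsAdapted

/-! ### Regions bounded by polygons -/

lemma polyCurve_subset_polyRegion (Q : ℤ → Plane) : polyCurve Q ⊆ polyRegion Q :=
  fun _ hx hx' => hx'.1 hx

lemma vertex_mem_polyRegion (Q : ℤ → Plane) (i : ℤ) : Q i ∈ polyRegion Q :=
  polyCurve_subset_polyRegion Q (mem_iUnion.2 ⟨i, left_mem_segment ℝ _ _⟩)

lemma polyRegion_comp_sub (Q : ℤ → Plane) (m : ℤ) :
    polyRegion (fun i => Q (i - m)) = polyRegion Q := by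
  have : polyCurve (fun i => Q (i - m)) = polyCurve Q := by
    have h := (Equiv.subRight m).surjective.iUnion_comp fun i => segment ℝ (Q i) (Q (i + 1))
    simpa [polyCurve, sub_add_eq_add_sub] using h
  rw [polyRegion, polyRegion, polyExterior, polyExterior, this]

lemma polyRegion_subset_closedBall {Q : ℤ → Plane} {c : Plane} {r : ℝ}
    (h : ∀ i, Q i ∈ Metric.closedBall c r) : polyRegion Q ⊆ Metric.closedBall c r := by
  have hcurve : polyCurve Q ⊆ Metric.closedBall c r :=
    iUnion_subset fun i => (convex_closedBall c r).segment_subset (h i) (h (i + 1))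
  refine fun x hx => by_contra fun hxb => hx ⟨fun hxc => hxb (hcurve hxc), fun hbd => ?_⟩
  rw [Metric.mem_closedBall, dist_eq_norm, not_le] at hxb
  have hr : 0 ≤ r := Metric.nonempty_closedBall.1 ⟨_, h 0⟩
  have hpos : 0 < ‖x - c‖ := hr.trans_lt hxb
  -- the ray from `x` away from `c` does not meet the ball
  have hray : Set.MapsTo (fun t : ℝ => x + t • (x - c)) (Ici 0) (polyCurve Q)ᶜ := by
    intro t ht hmem
    have := hcurve hmem
    have e : x + t • (x - c) - c = (1 + t) • (x - c) := by module
    have ht0 : (0 : ℝ) ≤ t := ht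
    rw [Metric.mem_closedBall, dist_eq_norm, e, norm_smul, Real.norm_of_nonneg (by linarith)]
      at this
    nlinarith [mul_nonneg ht0 hpos.le]
  have hjoin : ∀ t : ℝ, 0 ≤ t → JoinedIn (polyCurve Q)ᶜ x (x + t • (x - c)) := by
    intro t ht
    have hpc : IsPathConnected ((fun t : ℝ => x + t • (x - c)) '' Ici 0) :=
      ((convex_Ici 0).isPathConnected nonempty_Ici).image (by fun_prop)
    have := hpc.joinedIn x ⟨0, self_mem_Ici, by simp⟩ _ ⟨t, ht, rfl⟩
    exact this.mono hray.image_subset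
  obtain ⟨C, hC⟩ := isBounded_iff_forall_norm_le.1 hbd
  have hC0 : 0 ≤ C := (norm_nonneg _).trans (hC _ (hjoin 0 le_rfl))
  have h1 := hC _ (hjoin ((C + ‖x‖ + 1) / ‖x - c‖) (by positivity))
  have h2 : ‖((C + ‖x‖ + 1) / ‖x - c‖) • (x - c)‖ = C + ‖x‖ + 1 := by
    rw [norm_smul, Real.norm_of_nonneg (by positivity), div_mul_cancel₀ _ hpos.ne']
  have h3 := norm_sub_le (x + ((C + ‖x‖ + 1) / ‖x - c‖) • (x - c)) x
  rw [add_sub_cancel_left, h2] at h3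
  linarith

lemma IsAdapted.isCompact_polyCurve {n : ℕ} {B Q : ℤ → Plane} (hB : IsBall n B)
    (hQ : IsAdapted n B Q) : IsCompact (polyCurve Q) := by
  have hn : (0 : ℤ) < n := by have := hB.two_le; lia
  have : polyCurve Q = ⋃ i ∈ Ico (0 : ℤ) (0 + n), segment ℝ (Q i) (Q (i + 1)) := by
    refine Subset.antisymm (iUnion_subset fun i => ?_) (iUnion₂_subset fun i _ =>
      subset_iUnion (fun i => segment ℝ (Q i) (Q (i + 1))) i)
    have hper : Function.Periodic (fun i => segment ℝ (Q i) (Q (i + 1))) (n : ℤ) := fun i => by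
      simp only [show i + (n : ℤ) + 1 = i + 1 + n by ring, hQ.periodic]
    obtain ⟨k, hk, hik⟩ := hper.exists_mem_Ico hn i 0
    rw [hik]
    exact subset_biUnion_of_mem (u := fun i => segment ℝ (Q i) (Q (i + 1))) hk
  rw [this]
  refine (finite_Ico _ _).isCompact_biUnion fun i _ => ?_
  rw [segment_eq_image']
  exact isCompact_Icc.image (by fun_prop)

lemma isClosed_polyRegion {Q : ℤ → Plane} (hQ : IsClosed (polyCurve Q)) :
    IsClosed (polyRegion Q) := by
  rw [← isOpen_compl_iff, polyRegion, compl_compl, Metric.isOpen_iff]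
  rintro x ⟨hx, hunb⟩
  obtain ⟨ε, hε, hball⟩ := Metric.isOpen_iff.1 hQ.isOpen_compl x hx
  refine ⟨ε, hε, fun y hy => ⟨hball hy, fun hb => hunb (hb.subset fun z hz => ?_)⟩⟩
  have hyx := ((convex_ball x ε).isPathConnected ⟨x, Metric.mem_ball_self hε⟩).joinedIn
    y hy x (Metric.mem_ball_self hε)
  exact (hyx.mono hball).trans hz

/-! ### The iterated involute -/

/-- The involute, with respect to the dual ball, of the involute of `Q`, reindexed by the vertices
of `Q`. -/
noncomputable def secondInvolute (n : ℕ) (B Q : ℤ → Plane) (i : ℤ) : Plane :=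
  involute n (dualBall B) (involute n B Q) (i - 1)

namespace IsAdapted

variable {n : ℕ} {B Q : ℤ → Plane}

lemma side_secondInvolute (hB : IsBall n B) (hQ : IsAdapted n B Q) (i : ℤ) :
    side (secondInvolute n B Q) i =
      (-halfLength n (dualBall B) (involute n B Q) i) • side B i := by
  have h := (hQ.isAdapted_involute hB).side_involute hB.dual (i - 1)
  rw [sub_add_cancel] at h
  have h2 : side (dualBall (dualBall B)) (i - 1) = -side B i := by
    rw [side, hB.dual_dual, hB.dual_dual, side, sub_add_cancel]
    abel
  rw [h2] at h
  have h3 : side (secondInvolute n B Q) i =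
      side (involute n (dualBall B) (involute n B Q)) (i - 1) := by
    simp only [side, secondInvolute, sub_add_eq_add_sub]
  rw [h3, h, smul_neg, neg_smul]

lemma isAdapted_secondInvolute (hB : IsBall n B) (hQ : IsAdapted n B Q) :
    IsAdapted n B (secondInvolute n B Q) := by
  refine ⟨fun i => ?_, fun i => ⟨_, hQ.side_secondInvolute hB i⟩⟩
  have := ((hQ.isAdapted_involute hB).isAdapted_involute hB.dual).periodic (i - 1)
  rwa [sub_add_eq_add_sub] at this

lemma isCentralInvolute_secondInvolute (hB : IsBall n B) (hQ : IsAdapted n B Q) :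
    IsCentralInvolute n B (involute n B Q) (secondInvolute n B Q) := by
  have hN := hQ.isAdapted_involute hB
  refine ⟨fun i => ⟨_, hQ.side_secondInvolute hB i, ?_, ?_⟩,
    (hQ.isAdapted_secondInvolute hB).periodic⟩
  · have h := hN.involute_sub hB.dual (i - 1)
    rw [hB.dual_dual, sub_add_cancel] at h
    rw [← h, secondInvolute]
    module
  · have h : secondInvolute n B Q (i + 1) = involute n B Q i +
        halfLength n (dualBall B) (involute n B Q) i • dualBall (dualBall B) i := by
      rw [secondInvolute, add_sub_cancel_right]
      rfl
    rw [h, hB.dual_dual]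
    module

lemma sideRatio_secondInvolute (hB : IsBall n B) (hQ : IsAdapted n B Q) (i : ℤ) :
    sideRatio B (secondInvolute n B Q) i =
      -halfLength n (dualBall B) (involute n B Q) i :=
  side_of_parallel_det (hQ.side_secondInvolute hB i) (hB.det_succ_pos i).ne'

lemma sideRatio_secondInvolute_succ (hB : IsBall n B) (hQ : IsAdapted n B Q) (i : ℤ) :
    sideRatio B (secondInvolute n B Q) (i + 1) = sideRatio B (secondInvolute n B Q) i +
      det2 (dualBall B i) (dualBall B (i + 1)) * halfLength n B Q (i + 1) := by
  rw [hQ.sideRatio_secondInvolute hB, hQ.sideRatio_secondInvolute hB,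
    (hQ.isAdapted_involute hB).halfLength_succ hB.dual, hQ.sideRatio_involute hB]
  ring

lemma polyRegion_secondInvolute_subset (hB : IsBall n B) (hQ : IsAdapted n B Q) :
    polyRegion (secondInvolute n B Q) ⊆ polyRegion (involute n B Q) := by
  have h : secondInvolute n B Q =
      fun i => involute n (dualBall B) (involute n B Q) (i - 1) := rfl
  rw [h, polyRegion_comp_sub]
  exact (hQ.isAdapted_involute hB).polyRegion_involute_subset hB.dual

end IsAdapted

/-! ### Convergence to a point -/

/-- Summation by parts for antiperiodic sequences: the product of `α` with the image `α'` of another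
sequence equals the product of the intermediate sequences `β` and `β'` of the two, which is
symmetric. -/
lemma sum_by_parts {n : ℕ} {w w' α β α' β' : ℤ → ℝ}
    (hα' : ∀ i, α' (i + n) = -α' i) (hβ : ∀ i, β (i + n) = -β i)
    (h : ∀ i, β (i + 1) = β i - w i * α i)
    (h' : ∀ i, α' (i + 1) = α' i + w' i * β' (i + 1)) :
    ∑ i ∈ Finset.range n, w i * (α i * α' i) =
      ∑ i ∈ Finset.range n, w' i * (β (i + 1) * β' (i + 1)) := by
  have htel := Finset.sum_range_sub (fun i : ℕ => β i * α' i) n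
  have hend : β n * α' n = β 0 * α' 0 := by
    have h1 := hα' 0
    have h2 := hβ 0
    rw [zero_add] at h1 h2
    rw [h1, h2, neg_mul_neg]
  simp only [Nat.cast_zero, hend, sub_self] at htel
  rw [← sub_eq_zero, ← Finset.sum_sub_distrib, ← neg_eq_zero, ← Finset.sum_neg_distrib, ← htel]
  refine Finset.sum_congr rfl fun i _ => ?_
  push_cast
  rw [h', h]
  ring

/-- The moments `∑ w α ^ 2`, `∑ w' β ^ 2` of the orbit of a symmetric operator form a convex
sequence; if it is bounded, its second differences, the squared norms of the increments of the
orbit, tend to zero. -/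
lemma tendsto_sub_of_bounded {n : ℕ} {w w' : ℤ → ℝ} {α β : ℕ → ℤ → ℝ}
    (hw : ∀ i, 0 < w i) (hw' : ∀ i, 0 < w' i)
    (hα : ∀ k i, α k (i + n) = -α k i) (hβ : ∀ k i, β k (i + n) = -β k i)
    (h : ∀ k i, β k (i + 1) = β k i - w i * α k i)
    (h' : ∀ k i, α (k + 1) (i + 1) = α (k + 1) i + w' i * β k (i + 1))
    (hbdd : ∀ i, ∃ C, ∀ k, |α k i| ≤ C) {i : ℕ} (hi : i < n) :
    Tendsto (fun k => α (k + 1) i - α k i) atTop (𝓝 0) := by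
  choose C hC using hbdd
  set a : ℕ → ℕ → ℝ := fun k l => ∑ i ∈ Finset.range n, w i * (α k i * α l i) with ha
  set b : ℕ → ℕ → ℝ := fun k l =>
    ∑ i ∈ Finset.range n, w' i * (β k (i + 1) * β l (i + 1)) with hb
  have hab : ∀ k l, a k (l + 1) = b k l := fun k l =>
    sum_by_parts (hα (l + 1)) (hβ k) (h k) (h' l)
  have hsymm : ∀ k l, b k l = b l k := fun k l => by
    simp only [hb, mul_comm (β k _)]
  have hd : ∀ k, ∑ i ∈ Finset.range n, w i * (α (k + 1) i - α k i) ^ 2 =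
      a (k + 1) (k + 1) - 2 * b k k + a k k := by
    intro k
    rw [← hab]
    simp only [ha]
    rw [Finset.mul_sum, ← Finset.sum_sub_distrib, ← Finset.sum_add_distrib]
    exact Finset.sum_congr rfl fun i _ => by ring
  have hd' : ∀ k, 0 ≤ b (k + 1) (k + 1) - 2 * a (k + 1) (k + 1) + b k k := by
    intro k
    have : b (k + 1) (k + 1) - 2 * a (k + 1) (k + 1) + b k k =
        ∑ i ∈ Finset.range n, w' i * (β (k + 1) (i + 1) - β k (i + 1)) ^ 2 := by
      rw [hab, hsymm (k + 1) k]
      simp only [hb]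
      rw [Finset.mul_sum, ← Finset.sum_sub_distrib, ← Finset.sum_add_distrib]
      exact Finset.sum_congr rfl fun i _ => by ring
    rw [this]
    exact Finset.sum_nonneg fun i _ => mul_nonneg (hw' _).le (sq_nonneg _)
  have hterm : ∀ k, ∀ i ∈ Finset.range n, 0 ≤ w i * (α (k + 1) i - α k i) ^ 2 :=
    fun k i _ => mul_nonneg (hw _).le (sq_nonneg _)
  have hd0 := fun k => Finset.sum_nonneg (hterm k)
  set D : ℕ → ℝ := fun k => a k k - b k k with hD
  have hle : ∀ k, ∑ i ∈ Finset.range n, w i * (α (k + 1) i - α k i) ^ 2 ≤ D k - D (k + 1) := by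
    intro k
    rw [hd]
    simp only [hD]
    linarith [hd' k]
  have hanti : Antitone D := antitone_nat_of_succ_le fun k => by linarith [hle k, hd0 k]
  have ha_le : ∀ k, a k k ≤ ∑ i ∈ Finset.range n, w i * C i ^ 2 := by
    intro k
    refine Finset.sum_le_sum fun i _ => mul_le_mul_of_nonneg_left ?_ (hw i).le
    rw [← sq, ← sq_abs]
    exact pow_le_pow_left₀ (abs_nonneg _) (hC i k) 2
  have hbelow : BddBelow (range D) := by
    refine ⟨-∑ i ∈ Finset.range n, w i * C i ^ 2, ?_⟩
    rintro _ ⟨k, rfl⟩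
    have h1 := hd k
    have h2 := hd0 k
    have h3 : 0 ≤ a k k := Finset.sum_nonneg fun i _ =>
      mul_nonneg (hw i).le (mul_self_nonneg _)
    simp only [hD]
    linarith [ha_le k, ha_le (k + 1)]
  have hlim := tendsto_atTop_ciInf hanti hbelow
  have hdiff : Tendsto (fun k => D k - D (k + 1)) atTop (𝓝 0) := by
    simpa using hlim.sub (hlim.comp (tendsto_add_atTop_nat 1))
  have hsq : Tendsto (fun k => w i * (α (k + 1) i - α k i) ^ 2) atTop (𝓝 0) :=
    squeeze_zero (fun k => hterm k i (Finset.mem_range.2 hi))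
      (fun k => (Finset.single_le_sum (hterm k) (Finset.mem_range.2 hi)).trans (hle k)) hdiff
  have hsq' : Tendsto (fun k => (α (k + 1) i - α k i) ^ 2) atTop (𝓝 0) := by
    have := hsq.const_mul (w i)⁻¹
    simpa [← mul_assoc, inv_mul_cancel₀ (hw i).ne'] using this
  rw [tendsto_zero_iff_abs_tendsto_zero]
  simpa [Function.comp_def, Real.sqrt_sq_eq_abs] using hsq'.sqrt

/-- If the side ratios of the iterated involutes are bounded, they tend to zero. A limit of the
orbit would be a fixed point, hence of the form `i ↦ [x, V i]` with `x` the constant value of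
`α i • B i + β i • V i`; but these are orthogonal to the ratios of closed polygons. The proof
carries this out with errors that tend to zero. -/
lemma tendsto_sideRatio {n : ℕ} {B : ℤ → Plane} (hB : IsBall n B) {M : ℕ → ℤ → Plane}
    (hM : ∀ k, IsAdapted n B (M k)) (hsucc : ∀ k, M (k + 1) = secondInvolute n B (M k))
    (hbdd : ∀ i, ∃ C, ∀ k, |sideRatio B (M k) i| ≤ C) {i : ℕ} (hi : i < n) :
    Tendsto (fun k => sideRatio B (M k) i) atTop (𝓝 0) := by
  set V := dualBall B with hV
  set w : ℤ → ℝ := fun i => det2 (B i) (B (i + 1)) with hw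
  set w' : ℤ → ℝ := fun i => det2 (V i) (V (i + 1)) with hw'
  set α : ℕ → ℤ → ℝ := fun k => sideRatio B (M k) with hα
  set β : ℕ → ℤ → ℝ := fun k => halfLength n B (M k) with hβ
  have hw0 : ∀ i, 0 < w i := hB.det_succ_pos
  have hrec : ∀ k i, β k (i + 1) = β k i - w i * α k i := fun k i => by
    simp only [hβ, hw, hα]
    rw [(hM k).halfLength_succ hB, mul_comm]
  have hrec' : ∀ k i, α (k + 1) (i + 1) = α (k + 1) i + w' i * β k (i + 1) := fun k i => by
    simp only [hβ, hw', hα, hsucc k]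
    exact (hM k).sideRatio_secondInvolute_succ hB i
  have hinc : ∀ i : ℕ, i < n → Tendsto (fun k => α (k + 1) i - α k i) atTop (𝓝 0) := fun i hi =>
    tendsto_sub_of_bounded hw0 hB.dual.det_succ_pos
      (fun k => (hM k).sideRatio_antiperiodic hB) (fun k => (hM k).halfLength_antiperiodic hB)
      hrec hrec' hbdd hi
  set X : ℕ → ℤ → Plane := fun k i => α (k + 1) i • B i + β k i • V i with hX
  have hXsucc : ∀ k i, X k (i + 1) = X k i + (w i * (α (k + 1) i - α k i)) • V i := by
    intro k i
    have h1 : B (i + 1) = B i + w i • V i := by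
      rw [← hB.side_eq, side]
      abel
    have h2 : V (i + 1) = V i - w' i • B (i + 1) := by
      have := hB.side_dual i
      rw [neg_smul] at this
      rw [sub_eq_add_neg, ← this, side]
      abel
    simp only [hX]
    rw [hrec', h2, smul_sub, smul_smul, hrec, h1]
    module
  have hXlim : ∀ m : ℕ, m ≤ n → Tendsto (fun k => X k m - X k 0) atTop (𝓝 0) := by
    intro m
    induction m with
    | zero => simp
    | succ m ih =>
      intro hm
      have h1 := (ih (by lia)).add (((hinc m (by lia)).const_mul (w m)).smul_const (V m))
      rw [mul_zero, zero_smul, zero_add] at h1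
      refine h1.congr fun k => ?_
      push_cast
      rw [hXsucc]
      abel
  have hXV : ∀ k i, det2 (X k i) (V i) = α (k + 1) i := by
    intro k i
    simp only [hX]
    rw [det2_add_left, det2_smul_left, det2_smul_left, det2_self, hB.det_dual]
    ring
  have hclose : ∀ k, ∑ j ∈ Finset.range n, (w j * α k j) • V j = 0 := by
    intro k
    have h1 := Finset.sum_range_sub (fun j : ℕ => M k j) n
    have h2 := (hM k).periodic 0
    rw [zero_add] at h2
    simp only [Nat.cast_zero, h2, sub_self] at h1
    rw [← h1]
    refine Finset.sum_congr rfl fun j _ => ?_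
    have h3 := (hM k).side_eq_dual hB j
    rw [side] at h3
    push_cast
    rw [h3, mul_comm]
  have hnorm : ∀ k, ∑ j ∈ Finset.range n, w j * α (k + 1) j ^ 2 =
      ∑ j ∈ Finset.range n, w j * (α (k + 1) j * det2 (X k j - X k 0) (V j)) := by
    intro k
    have h1 := congrArg (det2 (X k 0)) (hclose (k + 1))
    rw [det2_sum_right, det2_zero_right] at h1
    rw [← sub_zero (∑ j ∈ Finset.range n, w j * α (k + 1) j ^ 2), ← h1, ← Finset.sum_sub_distrib]
    refine Finset.sum_congr rfl fun j _ => ?_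
    rw [det2_sub_left, hXV, det2_smul_right]
    ring
  have hlim : Tendsto (fun k => ∑ j ∈ Finset.range n, w j * α (k + 1) j ^ 2) atTop (𝓝 0) := by
    simp only [hnorm]
    rw [show 𝓝 (0 : ℝ) = 𝓝 (∑ _j ∈ Finset.range n, (0 : ℝ)) by simp]
    refine tendsto_finsetSum _ fun j hj => ?_
    rw [show 𝓝 (0 : ℝ) = 𝓝 (w j * 0) by simp]
    refine Tendsto.const_mul _ ?_
    obtain ⟨C, hC⟩ := hbdd j
    have h1 : Tendsto (fun k => det2 (X k j - X k 0) (V j)) atTop (𝓝 0) := by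
      have := ((continuous_det2_left (V j)).tendsto 0).comp
        (hXlim j (Finset.mem_range.1 hj).le)
      rwa [det2_zero_left] at this
    have h2 : Tendsto (fun k => C * |det2 (X k j - X k 0) (V j)|) atTop (𝓝 0) := by
      simpa using h1.abs.const_mul C
    refine squeeze_zero_norm (fun k => ?_) h2
    rw [Real.norm_eq_abs, abs_mul]
    exact mul_le_mul_of_nonneg_right (hC (k + 1)) (abs_nonneg _)
  have hterm : ∀ k, ∀ j ∈ Finset.range n, 0 ≤ w j * α (k + 1) j ^ 2 :=
    fun k j _ => mul_nonneg (hw0 _).le (sq_nonneg _)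
  have hsq : Tendsto (fun k => w i * α (k + 1) i ^ 2) atTop (𝓝 0) :=
    squeeze_zero (fun k => hterm k i (Finset.mem_range.2 hi))
      (fun k => Finset.single_le_sum (hterm k) (Finset.mem_range.2 hi)) hlim
  have hsq' : Tendsto (fun k => α (k + 1) i ^ 2) atTop (𝓝 0) := by
    have := hsq.const_mul (w i)⁻¹
    simpa [← mul_assoc, inv_mul_cancel₀ (hw0 i).ne'] using this
  refine (tendsto_add_atTop_iff_nat 1).1 ((tendsto_zero_iff_abs_tendsto_zero _).2 ?_)
  simpa [Function.comp_def, Real.sqrt_sq_eq_abs] using hsq'.sqrt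

lemma IsAdapted.dist_vertex_le {n : ℕ} {B Q : ℤ → Plane} (hB : IsBall n B)
    (hQ : IsAdapted n B Q) (i : ℤ) :
    dist (Q i) (Q 0) ≤ ∑ j ∈ Finset.range n, |sideRatio B Q j| * ‖side B j‖ := by
  have hn : (0 : ℤ) < n := by have := hB.two_le; lia
  obtain ⟨k, hk, hik⟩ := Function.Periodic.exists_mem_Ico (f := Q) hQ.periodic hn i 0
  lift k to ℕ using hk.1
  have hkn : k ≤ n := by have := hk.2; lia
  have h1 := Finset.sum_range_sub (fun j : ℕ => Q j) k
  rw [hik, dist_eq_norm]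
  simp only [Nat.cast_zero] at h1
  rw [← h1]
  calc ‖∑ j ∈ Finset.range k, (Q (j + 1 : ℕ) - Q j)‖
      ≤ ∑ j ∈ Finset.range k, ‖Q (j + 1 : ℕ) - Q j‖ := norm_sum_le _ _
    _ = ∑ j ∈ Finset.range k, |sideRatio B Q j| * ‖side B j‖ := by
        refine Finset.sum_congr rfl fun j _ => ?_
        rw [← Real.norm_eq_abs, ← norm_smul, ← hQ.side_eq hB, side]
        push_cast
        rfl
    _ ≤ ∑ j ∈ Finset.range n, |sideRatio B Q j| * ‖side B j‖ :=
        Finset.sum_le_sum_of_subset_of_nonneg (Finset.range_mono hkn) fun _ _ _ => by positivity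

lemma exists_sideRatio_bound {B : ℤ → Plane} {M : ℕ → ℤ → Plane} {c : Plane} {r : ℝ}
    (hM : ∀ k i, M k i ∈ Metric.closedBall c r) (i : ℤ) :
    ∃ C, ∀ k, |sideRatio B (M k) i| ≤ C := by
  have hcont : Continuous fun p : Plane × Plane =>
      det2 (B i) (p.1 - p.2) / det2 (B i) (B (i + 1)) :=
    ((continuous_det2_right (B i)).comp (continuous_fst.sub continuous_snd)).div_const _
  obtain ⟨C, hC⟩ := ((isCompact_closedBall c r).prod
    (isCompact_closedBall c r)).exists_bound_of_continuousOn hcont.continuousOn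
  exact ⟨C, fun k => hC (M k (i + 1), M k i) ⟨hM k _, hM k _⟩⟩

theorem mainTheorem1 (n : ℕ) (a : ℝ) (ha : 0 < a) (P : ℤ → Plane)
    (hP : IsConvexPolygonListing n P) :
    -- the polygons are the successive central involutes
    (∀ k : ℕ,
      IsCentralInvolute n (dualBall (unitBall n a P)) (fun i => polyM n a P k (i + 1))
        (polyN n a P k) ∧
      IsCentralInvolute n (unitBall n a P) (polyN n a P k) (polyM n a P (k + 1))) ∧
    -- constant width
    (∀ k : ℕ,
      HasConstantWidth n (unitBall n a P) (polyM n a P k) ∧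
      HasConstantWidth n (dualBall (unitBall n a P)) (polyN n a P k)) ∧
    -- nested regions
    (∀ k : ℕ,
      polyRegion (polyN n a P k) ⊆ polyRegion (polyM n a P k) ∧
      polyRegion (polyM n a P (k + 1)) ⊆ polyRegion (polyN n a P k)) ∧
    -- the intersection is one point, to which the polygons converge
    ∃ o : Plane,
      ((⋂ k : ℕ, polyRegion (polyM n a P k)) ∩ (⋂ k : ℕ, polyRegion (polyN n a P k)) = {o}) ∧
      Tendsto (fun k : ℕ => toNGon n (polyM n a P k)) atTop (𝓝 fun _ => o) ∧
      Tendsto (fun k : ℕ => toNGon n (polyN n a P k)) atTop (𝓝 fun _ => o) := by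
  have hU := hP.isBall_unitBall ha
  have hsucc : ∀ k, polyM n a P (k + 1) = secondInvolute n (unitBall n a P) (polyM n a P k) :=
    fun _ => rfl
  have hM : ∀ k, IsAdapted n (unitBall n a P) (polyM n a P k) := by
    intro k
    induction k with
    | zero => exact hP.isAdapted_centralEquidistant ha
    | succ k ih => exact ih.isAdapted_secondInvolute hU
  have hNM : ∀ k, polyRegion (polyN n a P k) ⊆ polyRegion (polyM n a P k) :=
    fun k => (hM k).polyRegion_involute_subset hU
  have hMN : ∀ k, polyRegion (polyM n a P (k + 1)) ⊆ polyRegion (polyN n a P k) :=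
    fun k => (hM k).polyRegion_secondInvolute_subset hU
  refine ⟨fun k => ⟨(hM k).isCentralInvolute hU, (hM k).isCentralInvolute_secondInvolute hU⟩,
    fun k => ⟨(hM k).hasConstantWidth hU, ((hM k).isAdapted_involute hU).hasConstantWidth hU.dual⟩,
    fun k => ⟨hNM k, hMN k⟩, ?_⟩
  set r : ℕ → ℝ := fun k => ∑ j ∈ Finset.range n,
    |sideRatio (unitBall n a P) (polyM n a P k) j| * ‖side (unitBall n a P) j‖ with hr
  have hball : ∀ k, polyRegion (polyM n a P k) ⊆ Metric.closedBall (polyM n a P k 0) (r k) :=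
    fun k => polyRegion_subset_closedBall fun i => (hM k).dist_vertex_le hU i
  have hanti : Antitone fun k => polyRegion (polyM n a P k) :=
    antitone_nat_of_succ_le fun k => (hMN k).trans (hNM k)
  have hr0 : Tendsto r atTop (𝓝 0) := by
    rw [← Finset.sum_const_zero (s := Finset.range n)]
    refine tendsto_finsetSum _ fun j hj => ?_
    have := (tendsto_sideRatio hU hM hsucc (exists_sideRatio_bound fun k i =>
      hball 0 (hanti (Nat.zero_le k) (vertex_mem_polyRegion _ i)))
      (Finset.mem_range.1 hj)).abs.mul_const ‖side (unitBall n a P) j‖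
    rwa [abs_zero, zero_mul] at this
  have hclosed : ∀ k, IsClosed (polyRegion (polyM n a P k)) := fun k =>
    isClosed_polyRegion ((hM k).isCompact_polyCurve hU).isClosed
  obtain ⟨o, ho⟩ := IsCompact.nonempty_iInter_of_sequence_nonempty_isCompact_isClosed
    (fun k => polyRegion (polyM n a P k)) (fun k => hanti k.le_succ)
    (fun k => ⟨_, vertex_mem_polyRegion _ 0⟩)
    ((isCompact_closedBall _ _).of_isClosed_subset (hclosed 0) (hball 0)) hclosed
  have hoM : ∀ k, o ∈ polyRegion (polyM n a P k) := mem_iInter.1 ho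
  have hdist : ∀ k, ∀ x ∈ polyRegion (polyM n a P k), dist x o ≤ 2 * r k := by
    intro k x hx
    have h1 := Metric.mem_closedBall.1 (hball k hx)
    have h2 := Metric.mem_closedBall'.1 (hball k (hoM k))
    linarith [dist_triangle x (polyM n a P k 0) o]
  have h2r : Tendsto (fun k => 2 * r k) atTop (𝓝 0) := by simpa using hr0.const_mul 2
  refine ⟨o, ?_, ?_, ?_⟩
  · refine Subset.antisymm (fun x hx => ?_) ?_
    · have hxM := mem_iInter.1 hx.1
      exact dist_le_zero.1 (ge_of_tendsto' h2r fun k => hdist k x (hxM k))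
    · rintro _ rfl
      exact ⟨ho, mem_iInter.2 fun k => hMN k (hoM (k + 1))⟩
  · refine tendsto_pi_nhds.2 fun i => tendsto_iff_dist_tendsto_zero.2 ?_
    exact squeeze_zero (fun _ => dist_nonneg)
      (fun k => hdist k _ (vertex_mem_polyRegion _ _)) h2r
  · refine tendsto_pi_nhds.2 fun i => tendsto_iff_dist_tendsto_zero.2 ?_
    exact squeeze_zero (fun _ => dist_nonneg)
      (fun k => hdist k _ (hNM k (vertex_mem_polyRegion _ _))) h2r
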